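/- Let $G$ be a finite group acting on a finite set $\Omega$, and let $\operatorname{Irr}(G)$ be the set of complex irreducible characters of $G$. For a conjugacy class $C$ of $G$ let $D_C\in\mathbb C^{G\times G}$ be the matrix with $D_C(x,y)=1$ if $x^{-1}y\in C$ and $D_C(x,y)=0$ otherwise, and let $\mathbb A$ be the linear span of these matrices (the Bose–Mesner algebra of the conjugacy class scheme of $G$). For $\chi\in\operatorname{Irr}(G)$ let $E_\chi\in\mathbb C^{G\times G}$ be given by $$E_\chi(x,y)=\frac{\chi(1)}{|G|}\,\chi(x^{-1}y),$$ and let $V_\chi\subseteq\mathbb C^G$ be the column space of $E_\chi$. Let $\xi(g)=|\{a\in\Omega: ga=a\}|$ be the permutation character of $G$ on $\Omega$, and let $I$ be the set of its irreducible constituents, that is, of all $\chi\in\operatorname{Irr}(G)$ with $\langle\xi,\chi\rangle=\frac1{|G|}\sum_{g\in G}\xi(g)\overline{\chi(g)}\neq0$. Let $M\in\mathbb C^{G\times(\Omega\times\Omega)}$ be the incidence matrix of the action: $M(g,(a,b))=1$ if $ga=b$, and $M(g,(a,b))=0$ otherwise. Then the following hold. 1. The matrices $E_\chi$, $\chi\in\operatorname{Irr}(G)$,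 form a basis of $\mathbb A$; they are Hermitian and satisfy $E_\chi E_\psi=\delta_{\chi\psi}E_\chi$. (So they are the minimal idempotents of $\mathbb A$, and the $V_\chi$ are the eigenspaces of the conjugacy class scheme.) 2. The column space of $M$ is the direct sum $\bigoplus_{\chi\in I}V_\chi$. 3. Suppose that $G$ acts transitively on $\Omega$, and let $Y$ be a non-empty subset of $G$. For $\chi\in\operatorname{Irr}(G)$ let $a'_\chi=\frac{|G|}{|Y|}\sum_{x,y\in Y}E_\chi(x,y)$; these numbers form the dual distribution of $Y$. Call $Y$ transitive on $\Omega$ if there is a constant $c>0$ such that for all $a,b\in\Omega$ there are exactly $c$ elements $g\in Y$ with $ga=b$. Then $Y$ is transitive on $\Omega$ if and only if $a'_\chi=0$ for every $\chi\in I$ other than the trivial character. -/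

import Mathlib

noncomputable section

namespace ConjScheme

open scoped ComplexConjugate

/-- `χ : G → ℂ` is the character of some irreducible complex representation `G → GL_n(ℂ)`. -/
def IsIrrChar {G : Type*} [Group G] (χ : G → ℂ) : Prop :=
  ∃ (n : ℕ) (ρ : Representation ℂ G (Fin n → ℂ)), ρ.IsIrreducible ∧ χ = ρ.character

/-- The set of (distinct) complex irreducible characters of `G`; it indexes the minimal
idempotents and the eigenspaces of the conjugacy class scheme. -/
abbrev IrrChar (G : Type*) [Group G] : Type _ := {χ : G → ℂ // IsIrrChar χ}

/-- The inner product `⟨φ, ψ⟩ = |G|⁻¹ ∑ φ(g) conj ψ(g)` of complex functions on `G`. -/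
def charInner {G : Type*} [Fintype G] (φ ψ : G → ℂ) : ℂ :=
  (1 / (Fintype.card G : ℂ)) * ∑ g, φ g * conj (ψ g)

/-- The permutation character `ξ(g) = |Fix(g)|` of `G` on `Ω`. -/
def permChar (G Ω : Type*) [Group G] [MulAction G Ω] : G → ℂ :=
  fun g => (Nat.card (MulAction.fixedBy Ω g) : ℂ)

/-- `χ` is an irreducible constituent of the permutation character of `G` on `Ω`. -/
def IsConstituent {G : Type*} (Ω : Type*) [Group G] [Fintype G] [MulAction G Ω]
    (χ : IrrChar G) : Prop :=
  charInner (permChar G Ω) χ.1 ≠ 0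

open Classical in
/-- The zero-one matrix `D_C` of a conjugacy class `C`: `D_C(x, y) = 1` iff `x⁻¹ y ∈ C`. -/
def classMatrix {G : Type*} [Group G] (C : ConjClasses G) : Matrix G G ℂ :=
  Matrix.of fun x y => if ConjClasses.mk (x⁻¹ * y) = C then 1 else 0

/-- The Bose-Mesner algebra of the conjugacy class scheme, as a space of matrices. -/
def boseMesner (G : Type*) [Group G] : Submodule ℂ (Matrix G G ℂ) :=
  Submodule.span ℂ (Set.range (classMatrix (G := G)))

/-- The idempotent `E_χ(x, y) = (deg χ / |G|) χ(x⁻¹ y)`, where `deg χ = χ(1)`. -/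
def idem {G : Type*} [Group G] [Fintype G] (χ : IrrChar G) : Matrix G G ℂ :=
  Matrix.of fun x y => (χ.1 1 / (Fintype.card G : ℂ)) * χ.1 (x⁻¹ * y)

/-- The space generated by the columns of a matrix. -/
def colSpace {X Z : Type*} (A : Matrix X Z ℂ) : Submodule ℂ (X → ℂ) :=
  Submodule.span ℂ (Set.range A.col)

/-- The eigenspace `V_χ` of the conjugacy class scheme: the column space of `E_χ`. -/
def eigenspace {G : Type*} [Group G] [Fintype G] (χ : IrrChar G) : Submodule ℂ (G → ℂ) :=
  colSpace (idem χ)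

open Classical in
/-- The incidence matrix of the action: `M(g, (a, b)) = 1` iff `g a = b`. -/
def incidence (G Ω : Type*) [Group G] [MulAction G Ω] : Matrix G (Ω × Ω) ℂ :=
  Matrix.of fun g p => if g • p.1 = p.2 then 1 else 0

/-- The dual distribution `a'_χ = (|G| / |Y|) ∑_{x, y ∈ Y} E_χ(x, y)` of a subset `Y` of `G`. -/
def dualDist {G : Type*} [Group G] [Fintype G] (Y : Finset G) (χ : IrrChar G) : ℂ :=
  ((Fintype.card G : ℂ) / (Y.card : ℂ)) * ∑ x ∈ Y, ∑ y ∈ Y, idem χ x y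

open Classical in
/-- A subset `Y` of `G` is transitive on `Ω` if there is a constant `c > 0` such that for all
`a, b` there are exactly `c` elements `g ∈ Y` with `g a = b`. -/
def IsTransitiveSubset {G : Type*} (Ω : Type*) [Group G] [MulAction G Ω] (Y : Finset G) : Prop :=
  ∃ c : ℕ, 0 < c ∧ ∀ a b : Ω, (Y.filter fun g => g • a = b).card = c

end ConjScheme

end

/-! Everything rests on the product `M Mᴴ`, whose `(x, y)` entry is `ξ(x⁻¹y)`. Expanding the class
function `ξ` in irreducible characters gives `M Mᴴ = ∑ ⟨ξ,χ⟩ (|G|/χ(1)) E_χ`, with nonzero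
coefficient exactly for the constituents. As `M` and `M Mᴴ` have the same column space and kernel of
adjoint, the orthogonal idempotents yield the direct sum, and `Mᴴ u = 0` iff `E_χ u = 0` for all
constituents `χ`.

For transitivity, `Mᴴ 1_Y` counts the `g ∈ Y` with `ga = b`, so `Y` is transitive iff `1_Y` minus a
multiple of `1_G` is killed by `Mᴴ`. For nontrivial `χ`, `E_χ` kills `1_G`, and `a'_χ` is a positive
multiple of `‖E_χ 1_Y‖²`.

The idempotent relations are the convolution identity for characters. That the `E_χ` span is
completeness: by Schur and Maschke, a class function orthogonal to all irreducible characters acts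
as zero on `ℂ[G]`. -/

namespace ConjScheme

open scoped ComplexConjugate MonoidAlgebra ComplexOrder
open Representation

/-! ### Unitarity, Schur's lemma and completeness of characters -/

section Representation

variable {G V : Type*} [Group G] [Fintype G] [AddCommGroup V] [Module ℂ V]
  [FiniteDimensional ℂ V]

/-- Every complex representation of a finite group is unitarizable, so `χ(g⁻¹) = conj χ(g)`. -/
theorem character_inv (ρ : Representation ℂ G V) (g : G) :
    ρ.character g⁻¹ = conj (ρ.character g) := by
  classical
  let b := Module.finBasis ℂ V
  let A : G → Matrix _ _ ℂ := fun g => LinearMap.toMatrix b b (ρ g)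
  have hA : ∀ g, ρ.character g = (A g).trace := fun g => LinearMap.trace_eq_matrix_trace ℂ b (ρ g)
  have hmul : ∀ g h, A (g * h) = A g * A h := fun g h => by
    simp only [A, map_mul]
    exact LinearMap.toMatrix_mul b _ _
  have hone : A 1 = 1 := by simp [A, Module.End.one_eq_id]
  -- An invariant positive definite form; it conjugates `A g⁻¹` to the conjugate transpose of `A g`,
  -- so their traces agree.
  let H := ∑ h, (A h).conjTranspose * A h
  have hH : H.PosDef := by
    have h1 : (∑ h ∈ Finset.univ.erase (1 : G), (A h).conjTranspose * A h).PosSemidef :=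
      Matrix.posSemidef_sum _ fun h _ => Matrix.posSemidef_conjTranspose_mul_self _
    have : H = 1 + ∑ h ∈ Finset.univ.erase (1 : G), (A h).conjTranspose * A h := by
      simp only [H]
      rw [← Finset.add_sum_erase _ _ (Finset.mem_univ (1 : G))]
      simp [hone]
    rw [this]
    exact Matrix.PosDef.one.add_posSemidef h1
  have hinv : (A g).conjTranspose * H * A g = H := by
    simp only [H, Finset.mul_sum, Finset.sum_mul]
    refine Fintype.sum_equiv (Equiv.mulRight g) _ _ fun h => ?_
    simp [hmul, Matrix.mul_assoc, Matrix.conjTranspose_mul]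
  have hcomm : H * A g⁻¹ = (A g).conjTranspose * H := by
    conv_lhs => rw [← hinv]
    rw [Matrix.mul_assoc, ← hmul]
    simp [hone]
  have hdet : IsUnit H.det := hH.isUnit.map Matrix.detMonoidHom
  have : A g⁻¹ = H⁻¹ * ((A g).conjTranspose * H) := by
    rw [← hcomm, Matrix.nonsing_inv_mul_cancel_left _ _ hdet]
  rw [hA, hA, this, Matrix.trace_mul_comm, Matrix.mul_assoc, Matrix.mul_nonsing_inv _ hdet,
    Matrix.mul_one, Matrix.trace_conjTranspose]
  rfl

omit [Fintype G] in
theorem finrank_ne_zero_of_isIrreducible (ρ : Representation ℂ G V)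
    [ρ.IsIrreducible] : (Module.finrank ℂ V : ℂ) ≠ 0 := by
  have : Nontrivial V := IsSimpleModule.nontrivial ℂ[G] ρ.asModule
  exact_mod_cast Module.finrank_pos.ne'

/-- Schur's lemma: a class function acts as a scalar on an irreducible representation. -/
theorem sum_smul_eq_smul_one (ρ : Representation ℂ G V) [ρ.IsIrreducible] (f : G → ℂ)
    (hf : ∀ g h, f (h * g * h⁻¹) = f g) :
    ∑ g, f g • ρ g =
      ((∑ g, f g * ρ.character g) / Module.finrank ℂ V) • (1 : Module.End ℂ V) := by
  have hT : ∀ h v, (∑ g, f g • ρ g) (ρ h v) = ρ h ((∑ g, f g • ρ g) v) := by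
    intro h v
    simp only [LinearMap.sum_apply, LinearMap.smul_apply, map_sum, map_smul]
    refine Fintype.sum_equiv (MulAut.conj h⁻¹).toEquiv _ _ fun g => ?_
    have h1 := hf g h⁻¹
    simp only [inv_inv] at h1
    simp only [mul_assoc] at h1
    simp [h1, ← Module.End.mul_apply, ← map_mul, mul_assoc]
  obtain ⟨c, hc⟩ := (IsIrreducible.algebraMap_intertwiningMap_bijective_of_isAlgClosed
    (ρ := ρ)).2 ⟨∑ g, f g • ρ g, fun h => LinearMap.ext fun v => hT h v⟩
  have hc' : ∑ g, f g • ρ g = c • (1 : Module.End ℂ V) := by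
    have := congrArg IntertwiningMap.toLinearMap hc
    exact this.symm
  have ht := congrArg (LinearMap.trace ℂ V) hc'
  simp only [map_sum, map_smul, LinearMap.trace_one, smul_eq_mul] at ht
  rw [hc']
  congr 1
  rw [eq_div_iff (finrank_ne_zero_of_isIrreducible ρ), ← ht]
  rfl

omit [Fintype G] in
/-- The character of an irreducible representation on any space is an irreducible character. -/
theorem isIrrChar_character (ρ : Representation ℂ G V) [ρ.IsIrreducible] :
    IsIrrChar ρ.character := by
  let e : V ≃ₗ[ℂ] (Fin (Module.finrank ℂ V) → ℂ) := (Module.finBasis ℂ V).equivFun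
  let σ : Representation ℂ G (Fin (Module.finrank ℂ V) → ℂ) :=
    { toFun := fun g => e.conj (ρ g)
      map_one' := by simp [Module.End.one_eq_id]
      map_mul' := fun g h => by simp [Module.End.mul_eq_comp, LinearEquiv.conj_comp] }
  let φ : Representation.Equiv ρ σ := Representation.Equiv.mk e fun g => by
    ext v
    simp [σ, LinearEquiv.conj_apply]
  refine ⟨_, σ, ?_, char_iso φ⟩
  rw [irreducible_iff_isSimpleModule_asModule]
  let ψ := LinearEquiv.ofBijective
    (IntertwiningMap.equivLinearMapAsModule ρ σ φ.toIntertwiningMap) e.bijective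
  exact IsSimpleModule.congr ψ.symm

omit [Fintype G] [FiniteDimensional ℂ V] in
theorem asAlgebraHom_ofModule' [Module ℂ[G] V] [IsScalarTower ℂ ℂ[G] V] :
    (ofModule' (k := ℂ) (G := G) V).asAlgebraHom = Algebra.lsmul ℂ ℂ V :=
  Equiv.apply_symm_apply _ _

omit [Fintype G] [FiniteDimensional ℂ V] in
theorem isIrreducible_ofModule' [Module ℂ[G] V] [IsScalarTower ℂ ℂ[G] V]
    [IsSimpleModule ℂ[G] V] : (ofModule' (k := ℂ) (G := G) V).IsIrreducible := by
  rw [irreducible_iff_isSimpleModule_asModule]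
  let e : (ofModule' (k := ℂ) (G := G) V).asModule ≃ₗ[ℂ[G]] V :=
    { (asModuleEquiv (ofModule' (k := ℂ) (G := G) V)).toAddEquiv with
      map_smul' := fun r v =>
        congrArg (fun φ => φ r (asModuleEquiv (ofModule' (k := ℂ) (G := G) V) v))
          (asAlgebraHom_ofModule' (G := G) (V := V)) }
  exact IsSimpleModule.congr e

/-- If a class function is orthogonal to all irreducible characters, the corresponding element of
the group algebra kills every simple module. -/
theorem smul_eq_zero_of_isSimpleModule (f : G → ℂ) (hf : ∀ g h, f (h * g * h⁻¹) = f g)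
    (h0 : ∀ χ : IrrChar G, ∑ g, f g * χ.1 g = 0) [Module ℂ[G] V] [IsScalarTower ℂ ℂ[G] V]
    [IsSimpleModule ℂ[G] V] (v : V) :
    (∑ g, MonoidAlgebra.single g (f g) : ℂ[G]) • v = 0 := by
  have := isIrreducible_ofModule' (G := G) (V := V)
  have h1 := sum_smul_eq_smul_one (ofModule' (k := ℂ) (G := G) V) f hf
  have h4 := h0 ⟨_, isIrrChar_character (ofModule' (k := ℂ) (G := G) V)⟩
  simp only at h4
  rw [h4, zero_div, zero_smul] at h1
  have h2 : (ofModule' (k := ℂ) (G := G) V).asAlgebraHom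
      (∑ g, MonoidAlgebra.single g (f g)) = 0 := by
    simpa only [map_sum, asAlgebraHom_single] using h1
  rw [asAlgebraHom_ofModule'] at h2
  exact congrArg (fun T => T v) h2

/-- A class function orthogonal to all irreducible characters vanishes. -/
theorem eq_zero_of_forall_irrChar (f : G → ℂ) (hf : ∀ g h, f (h * g * h⁻¹) = f g)
    (h0 : ∀ χ : IrrChar G, ∑ g, f g * χ.1 g = 0) : f = 0 := by
  have : NeZero (Nat.card G : ℂ) := ⟨by simp⟩
  let a : ℂ[G] := ∑ g, MonoidAlgebra.single g (f g)
  -- Maschke: `ℂ[G]` is the sum of its simple submodules, so killing these kills `1`.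
  have hv : (1 : ℂ[G]) ∈ sSup {S : Submodule ℂ[G] ℂ[G] | IsSimpleModule ℂ[G] S} := by
    rw [IsSemisimpleModule.sSup_simples_eq_top]; trivial
  have ha : a • (1 : ℂ[G]) = 0 := by
    rw [sSup_eq_iSup'] at hv
    refine Submodule.iSup_induction _ (motive := fun v => a • v = 0) hv ?_ (smul_zero _) ?_
    · rintro ⟨S, hS⟩ v hv
      have : IsSimpleModule ℂ[G] S := hS
      have : FiniteDimensional ℂ S :=
        inferInstanceAs (FiniteDimensional ℂ (S.restrictScalars ℂ))
      exact congrArg Subtype.val (smul_eq_zero_of_isSimpleModule f hf h0 (⟨v, hv⟩ : S))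
    · intro x y hx hy
      rw [smul_add, hx, hy, add_zero]
  rw [smul_eq_mul, mul_one] at ha
  funext g
  have := congrArg (fun b : ℂ[G] => b.coeff g) ha
  classical simpa [a, Finsupp.single_apply] using this

end Representation

/-! ### Orthogonality and expansion of class functions -/

section IrrChar

variable {G : Type*} [Group G]

theorem IrrChar.conj_apply (χ : IrrChar G) (g h : G) : χ.1 (h * g * h⁻¹) = χ.1 g := by
  obtain ⟨_, n, ρ, hρ, rfl⟩ := χ
  exact char_conj ρ g h

theorem IrrChar.one_ne_zero (χ : IrrChar G) : χ.1 1 ≠ 0 := by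
  obtain ⟨_, n, ρ, hρ, rfl⟩ := χ
  simp only [char_one]
  exact finrank_ne_zero_of_isIrreducible ρ

theorem isIrrChar_one : IsIrrChar (fun _ : G => (1 : ℂ)) := by
  let ρ : Representation ℂ G ℂ := Representation.trivial ℂ G ℂ
  have : ρ.IsIrreducible := by
    have hn : Nontrivial (Subrepresentation ρ) := by
      refine ⟨⊥, ⊤, fun h => ?_⟩
      have := congrArg Subrepresentation.toSubmodule h
      exact bot_ne_top (α := Submodule ℂ ℂ) this
    refine ⟨fun S => ?_⟩
    rcases eq_bot_or_eq_top S.toSubmodule with h | h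
    · exact Or.inl (Subrepresentation.toSubmodule_injective h)
    · exact Or.inr (Subrepresentation.toSubmodule_injective h)
  convert isIrrChar_character ρ
  simp [ρ, Representation.character]

variable [Fintype G]

theorem IrrChar.inv_apply (χ : IrrChar G) (g : G) : χ.1 g⁻¹ = conj (χ.1 g) := by
  obtain ⟨_, n, ρ, hρ, rfl⟩ := χ
  exact character_inv ρ g

open Classical in
theorem IrrChar.sum_inv_mul (χ ψ : IrrChar G) :
    ∑ g, χ.1 g⁻¹ * ψ.1 g = if χ = ψ then (Fintype.card G : ℂ) else 0 := by
  obtain ⟨_, n, ρ, hρ, rfl⟩ := χ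
  obtain ⟨_, m, σ, hσ, rfl⟩ := ψ
  have hc : (Nat.card G : ℂ) ≠ 0 := by simp
  have : Invertible (Nat.card G : ℂ) := invertibleOfNonzero hc
  have key : ∀ (n m : ℕ) (ρ : Representation ℂ G (Fin n → ℂ))
      (σ : Representation ℂ G (Fin m → ℂ)) [ρ.IsIrreducible] [σ.IsIrreducible],
      ∑ g, ρ.character g⁻¹ * σ.character g =
        if Nonempty (Representation.Equiv ρ σ) then (Nat.card G : ℂ) else 0 := by
    intro n m ρ σ _ _
    have h := char_orthonormal σ ρ
    rw [inv_mul_eq_iff_eq_mul₀ hc] at h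
    simp only [mul_comm (ρ.character _⁻¹), h, mul_ite, mul_one, mul_zero]
  rw [key n m ρ σ, ← Nat.card_eq_fintype_card]
  refine if_congr ?_ rfl rfl
  refine ⟨fun ⟨φ⟩ => Subtype.ext (char_iso φ), fun h => ?_⟩
  -- Equal characters of non-isomorphic representations would have norm sum both `0` and `|G|`.
  by_contra hne
  have h1 := key n m ρ σ
  have h2 := key n n ρ ρ
  have h' : ρ.character = σ.character := congrArg Subtype.val h
  rw [if_neg hne, ← h'] at h1
  rw [h1, if_pos ⟨Representation.Equiv.refl ρ⟩] at h2
  exact hc h2.symm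

open Classical in
/-- The convolution of irreducible characters. -/
theorem IrrChar.sum_inv_mul_mul (χ ψ : IrrChar G) (h : G) :
    ∑ g, χ.1 g⁻¹ * ψ.1 (g * h) =
      if χ = ψ then (Fintype.card G : ℂ) / χ.1 1 * χ.1 h else 0 := by
  have hs := IrrChar.sum_inv_mul χ ψ
  have hcl : ∀ g h : G, χ.1 (h * g * h⁻¹)⁻¹ = χ.1 g⁻¹ := fun g h => by
    rw [← χ.conj_apply g⁻¹ h]; simp [mul_assoc]
  obtain ⟨ψ', m, σ, hσ, hψ⟩ := ψ
  subst hψ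
  have h1 := sum_smul_eq_smul_one σ (fun g => χ.1 g⁻¹) hcl
  -- Multiplying Schur's scalar identity by `σ h` and taking the trace turns it into the
  -- convolution.
  have h2 := congrArg (fun T => LinearMap.trace ℂ _ (T * σ h)) h1
  simp only [Finset.sum_mul, map_sum, smul_mul_assoc, map_smul, one_mul, smul_eq_mul,
    ← map_mul] at h2
  change ∑ g, χ.1 g⁻¹ * σ.character (g * h) = _ * σ.character h at h2
  simp only [h2, hs]
  split_ifs with heq
  · subst heq
    simp
  · simp

theorem IrrChar.linearIndependent :
    LinearIndependent ℂ (fun χ : IrrChar G => χ.1) := by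
  classical
  rw [linearIndependent_iff']
  intro s c hc χ hχ
  have h := congrArg (fun f : G → ℂ => ∑ g, χ.1 g⁻¹ * f g) hc
  simp only [Finset.sum_apply, Pi.smul_apply, smul_eq_mul, Finset.mul_sum, Pi.zero_apply,
    mul_zero, Finset.sum_const_zero] at h
  rw [Finset.sum_comm] at h
  simp only [mul_left_comm _ (c _), ← Finset.mul_sum, IrrChar.sum_inv_mul] at h
  simpa [hχ] using h

instance : Finite (IrrChar G) := IrrChar.linearIndependent.finite

noncomputable instance : Fintype (IrrChar G) := Fintype.ofFinite _

/-- Every class function is a combination of irreducible characters. -/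
theorem eq_sum_charInner_smul (f : G → ℂ) (hf : ∀ g h, f (h * g * h⁻¹) = f g) :
    f = ∑ χ : IrrChar G, charInner f χ.1 • χ.1 := by
  classical
  let d : G → ℂ := f - ∑ χ : IrrChar G, charInner f χ.1 • χ.1
  -- The completeness lemma pairs without conjugation, hence the inverse.
  have hd : (fun g => d g⁻¹) = 0 := by
    refine eq_zero_of_forall_irrChar _ (fun g h => ?_) fun ψ => ?_
    · have : (h * g * h⁻¹)⁻¹ = h * g⁻¹ * h⁻¹ := by simp [mul_assoc]
      simp [this, d, hf, IrrChar.conj_apply]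
    · rw [← Equiv.sum_comp (Equiv.inv G)]
      simp only [Equiv.inv_apply, inv_inv, d, Pi.sub_apply, Finset.sum_apply, Pi.smul_apply,
        smul_eq_mul, sub_mul, Finset.sum_sub_distrib, Finset.sum_mul]
      rw [Finset.sum_comm]
      simp only [mul_assoc, ← Finset.mul_sum]
      have h : ∀ χ : IrrChar G, ∑ g, χ.1 g * ψ.1 g⁻¹ =
          if ψ = χ then (Fintype.card G : ℂ) else 0 := fun χ => by
        simp only [mul_comm (χ.1 _), IrrChar.sum_inv_mul]
      simp only [h]
      have hc : (Fintype.card G : ℂ) ≠ 0 := by simp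
      simp [charInner, IrrChar.inv_apply]
      rw [mul_comm _⁻¹, inv_mul_cancel_right₀ hc, sub_self]
  funext g
  have := congrFun hd g⁻¹
  simpa [d, sub_eq_zero] using this

end IrrChar

end ConjScheme

namespace ConjScheme

open scoped ComplexConjugate ComplexOrder
open Matrix

/-! ### The idempotents and eigenspaces of the scheme -/

section Idempotents

variable {G : Type*} [Group G] [Fintype G]

theorem isHermitian_idem (χ : IrrChar G) : (idem χ).IsHermitian := by
  ext x y
  have h1 : conj (χ.1 1) = χ.1 1 := by rw [← χ.inv_apply, inv_one]
  simp [idem, Matrix.conjTranspose_apply, h1, ← χ.inv_apply]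

open Classical in
theorem idem_mul_idem (χ ψ : IrrChar G) :
    idem χ * idem ψ = if χ = ψ then idem χ else 0 := by
  have hc : (Fintype.card G : ℂ) ≠ 0 := by simp
  ext x y
  have h1 : ∀ z, idem χ x z * idem ψ z y =
      χ.1 1 / Fintype.card G * (ψ.1 1 / Fintype.card G) * (χ.1 (x⁻¹ * z) * ψ.1 (z⁻¹ * y)) := by
    intro z; simp only [idem, Matrix.of_apply]; ring
  simp only [Matrix.mul_apply, h1, ← Finset.mul_sum]
  -- Substitute `g = z⁻¹x`.
  have h2 : ∑ z, χ.1 (x⁻¹ * z) * ψ.1 (z⁻¹ * y) =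
      ∑ g, χ.1 g⁻¹ * ψ.1 (g * (x⁻¹ * y)) := by
    refine Fintype.sum_equiv ((Equiv.inv G).trans (Equiv.mulRight x)) _ _ fun z => ?_
    simp [mul_assoc]
  rw [h2, IrrChar.sum_inv_mul_mul]
  have := χ.one_ne_zero
  split_ifs with h
  · subst h
    simp only [idem, Matrix.of_apply]
    field_simp
  · simp

theorem idem_ne_zero (χ : IrrChar G) : idem χ ≠ 0 := by
  intro h
  have := congrFun (congrFun h 1) 1
  simp [idem, χ.one_ne_zero] at this

theorem linearIndependent_idem :
    LinearIndependent ℂ (idem : IrrChar G → Matrix G G ℂ) := by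
  classical
  rw [linearIndependent_iff']
  intro s c hc χ hχ
  have h := congrArg (fun A => idem χ * A) hc
  simpa [Finset.mul_sum, idem_mul_idem, hχ, idem_ne_zero] using h

/-- The matrix of a class function is a combination of the idempotents. -/
theorem of_inv_mul_eq_sum_idem (f : G → ℂ) (hf : ∀ g h, f (h * g * h⁻¹) = f g) :
    (Matrix.of fun x y => f (x⁻¹ * y)) =
      ∑ χ : IrrChar G, (charInner f χ.1 * (Fintype.card G / χ.1 1)) • idem χ := by
  ext x y
  have hc : (Fintype.card G : ℂ) ≠ 0 := by simp
  rw [Matrix.of_apply, congrFun (eq_sum_charInner_smul f hf) (x⁻¹ * y)]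
  simp only [Finset.sum_apply, Matrix.sum_apply, Pi.smul_apply, Matrix.smul_apply, smul_eq_mul,
    idem, Matrix.of_apply]
  refine Finset.sum_congr rfl fun χ _ => ?_
  have := χ.one_ne_zero
  field_simp

theorem span_idem :
    Submodule.span ℂ (Set.range (idem : IrrChar G → Matrix G G ℂ)) = boseMesner G := by
  classical
  refine le_antisymm (Submodule.span_le.2 ?_) (Submodule.span_le.2 ?_)
  · rintro _ ⟨χ, rfl⟩
    have hlift : ∀ a b : G, IsConj a b → χ.1 a = χ.1 b := fun a b h => by
      obtain ⟨c, rfl⟩ := isConj_iff.1 h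
      exact (χ.conj_apply a c).symm
    let φ : ConjClasses G → ℂ := Quotient.lift χ.1 hlift
    have : idem χ = ∑ C, (χ.1 1 / Fintype.card G * φ C) • classMatrix C := by
      ext x y
      simp [Matrix.sum_apply, idem, classMatrix]
      exact Or.inl rfl
    rw [this]
    exact Submodule.sum_mem _ fun C _ => Submodule.smul_mem _ _
      (Submodule.subset_span ⟨C, rfl⟩)
  · rintro _ ⟨C, rfl⟩
    have := of_inv_mul_eq_sum_idem (fun g : G => if ConjClasses.mk g = C then (1 : ℂ) else 0)
      fun g h => by
        have : ConjClasses.mk (h * g * h⁻¹) = ConjClasses.mk g :=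
          ConjClasses.mk_eq_mk_iff_isConj.2 (isConj_iff.2 ⟨h, rfl⟩).symm
        simp only [this]
    have h2 : classMatrix C =
        Matrix.of fun x y : G => if ConjClasses.mk (x⁻¹ * y) = C then (1 : ℂ) else 0 := by
      ext x y
      simp [classMatrix]
    rw [h2, this]
    exact Submodule.sum_mem _ fun χ _ => Submodule.smul_mem _ _
      (Submodule.subset_span ⟨χ, rfl⟩)

omit [Group G] [Fintype G] in
theorem colSpace_eq_range {Z : Type*} [Fintype Z] (A : Matrix G Z ℂ) :
    colSpace A = LinearMap.range A.mulVecLin :=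
  (Matrix.range_mulVecLin A).symm

/-- `E_χ` fixes `V_χ` pointwise and annihilates every other `V_ψ`. -/
theorem iSupIndep_eigenspace : iSupIndep (eigenspace : IrrChar G → Submodule ℂ (G → ℂ)) := by
  classical
  rw [iSupIndep_def]
  intro χ
  rw [Submodule.disjoint_def]
  intro v hv hv'
  have h1 : ∀ ψ : IrrChar G, ∀ u ∈ eigenspace ψ, idem χ *ᵥ u = if χ = ψ then u else 0 := by
    rintro ψ u hu
    rw [eigenspace, colSpace_eq_range] at hu
    obtain ⟨w, rfl⟩ := hu
    rw [Matrix.mulVecLin_apply, Matrix.mulVec_mulVec, idem_mul_idem]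
    split_ifs with h
    · rw [h]
    · simp
  have h2 : (⨆ j, ⨆ (_ : j ≠ χ), eigenspace j) ≤ LinearMap.ker (idem χ).mulVecLin :=
    iSup₂_le fun ψ hψ u hu => by
      simp [h1 ψ u hu, hψ.symm]
  have h3 := h1 χ v hv
  rw [if_pos rfl] at h3
  rw [← h3]
  exact h2 hv'

end Idempotents

/-! ### The incidence matrix and transitive subsets -/

section Action

variable {G Ω : Type*} [Group G] [Fintype G] [Fintype Ω] [MulAction G Ω]

omit [Fintype G] [Fintype Ω] in
theorem permChar_conj (g h : G) : permChar G Ω (h * g * h⁻¹) = permChar G Ω g := by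
  simp only [permChar]
  congr 1
  refine Nat.card_congr ((MulAction.toPerm h⁻¹).subtypeEquiv fun a => ?_)
  simp [MulAction.mem_fixedBy, mul_smul, ← eq_inv_smul_iff (g := h)]

-- Both count the points `a` with `xa = ya`, i.e. the fixed points of `x⁻¹y`.
omit [Fintype G] in
theorem incidence_mul_conjTranspose :
    incidence G Ω * (incidence G Ω)ᴴ = Matrix.of fun x y => permChar G Ω (x⁻¹ * y) := by
  classical
  ext x y
  have h : ∀ a : Ω, x • a = y • a ↔ a ∈ MulAction.fixedBy Ω (x⁻¹ * y) := fun a => by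
    rw [MulAction.mem_fixedBy, mul_smul, inv_smul_eq_iff, eq_comm]
  simp only [Matrix.mul_apply, Fintype.sum_prod_type, incidence, Matrix.conjTranspose_apply,
    Matrix.of_apply]
  simp [permChar, apply_ite, Nat.card_eq_fintype_card, Fintype.card_subtype, eq_comm, h]

theorem incidence_mul_conjTranspose_eq_sum :
    incidence G Ω * (incidence G Ω)ᴴ = ∑ χ : IrrChar G,
      (charInner (permChar G Ω) χ.1 * (Fintype.card G / χ.1 1)) • idem χ := by
  rw [incidence_mul_conjTranspose, of_inv_mul_eq_sum_idem _ permChar_conj]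

open Classical in
theorem idem_mul_incidence_mul_conjTranspose (χ : IrrChar G) :
    idem χ * (incidence G Ω * (incidence G Ω)ᴴ) =
      (charInner (permChar G Ω) χ.1 * (Fintype.card G / χ.1 1)) • idem χ := by
  simp [incidence_mul_conjTranspose_eq_sum, Finset.mul_sum, idem_mul_idem]

omit [Fintype Ω] in
theorem constituent_coeff_ne_zero {χ : IrrChar G} (h : IsConstituent Ω χ) :
    charInner (permChar G Ω) χ.1 * (Fintype.card G / χ.1 1) ≠ 0 :=
  mul_ne_zero h (div_ne_zero (by simp) χ.one_ne_zero)

theorem conjTranspose_incidence_mulVec_eq_zero_iff (u : G → ℂ) :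
    (incidence G Ω)ᴴ *ᵥ u = 0 ↔ ∀ χ : IrrChar G, IsConstituent Ω χ → idem χ *ᵥ u = 0 := by
  constructor
  · intro h χ hχ
    have h1 : (idem χ * (incidence G Ω * (incidence G Ω)ᴴ)) *ᵥ u = 0 := by
      simp [← Matrix.mulVec_mulVec, h]
    rw [idem_mul_incidence_mul_conjTranspose, Matrix.smul_mulVec] at h1
    exact (smul_eq_zero.1 h1).resolve_left (constituent_coeff_ne_zero hχ)
  · intro h
    rw [← Matrix.self_mul_conjTranspose_mulVec_eq_zero, incidence_mul_conjTranspose_eq_sum,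
      Matrix.sum_mulVec]
    refine Finset.sum_eq_zero fun χ _ => ?_
    by_cases hχ : IsConstituent Ω χ
    · simp [Matrix.smul_mulVec, h χ hχ]
    · rw [IsConstituent, not_not] at hχ
      simp [hχ]

theorem colSpace_mul_conjTranspose {X Z : Type*} [Fintype X] [Fintype Z] (A : Matrix X Z ℂ) :
    colSpace (A * Aᴴ) = colSpace A := by
  refine Submodule.eq_of_le_of_finrank_eq ?_ ?_
  · rw [colSpace, ← Matrix.range_mulVecLin, colSpace, ← Matrix.range_mulVecLin,
      Matrix.mulVecLin_mul]
    exact LinearMap.range_comp_le_range _ _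
  · rw [colSpace, colSpace, ← Matrix.rank_eq_finrank_span_cols,
      ← Matrix.rank_eq_finrank_span_cols, Matrix.rank_self_mul_conjTranspose]

theorem colSpace_incidence :
    colSpace (incidence G Ω) =
      ⨆ χ : {χ : IrrChar G // IsConstituent Ω χ}, eigenspace χ.1 := by
  classical
  rw [← colSpace_mul_conjTranspose]
  refine le_antisymm ?_ (iSup_le fun χ => ?_)
  · rw [colSpace_eq_range]
    rintro _ ⟨u, rfl⟩
    rw [incidence_mul_conjTranspose_eq_sum, Matrix.mulVecLin_apply, Matrix.sum_mulVec]
    refine Submodule.sum_mem _ fun χ _ => ?_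
    by_cases hχ : IsConstituent Ω χ
    · refine Submodule.mem_iSup_of_mem ⟨χ, hχ⟩ ?_
      rw [Matrix.smul_mulVec, eigenspace, colSpace_eq_range]
      exact Submodule.smul_mem _ _ ⟨u, rfl⟩
    · rw [IsConstituent, not_not] at hχ
      simp [hχ]
  · rw [eigenspace, colSpace_eq_range, colSpace_eq_range]
    rintro _ ⟨u, rfl⟩
    have hc := constituent_coeff_ne_zero χ.2
    refine ⟨(charInner (permChar G Ω) χ.1.1 * (Fintype.card G / χ.1.1 1))⁻¹ •
      (idem χ.1 *ᵥ u), ?_⟩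
    have h1 : (incidence G Ω * (incidence G Ω)ᴴ) * idem χ.1 =
        (charInner (permChar G Ω) χ.1.1 * (Fintype.card G / χ.1.1 1)) • idem χ.1 := by
      simp [incidence_mul_conjTranspose_eq_sum, Finset.sum_mul, idem_mul_idem]
    rw [map_smul, Matrix.mulVecLin_apply, Matrix.mulVec_mulVec, h1, Matrix.smul_mulVec,
      inv_smul_smul₀ hc]
    rfl

open Classical in
/-- The characteristic vector of a subset. -/
noncomputable def charVec (Y : Finset G) : G → ℂ := fun g => if g ∈ Y then 1 else 0

open Classical in
omit [Fintype Ω] in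
theorem conjTranspose_incidence_mulVec_charVec (Y : Finset G) (a b : Ω) :
    ((incidence G Ω)ᴴ *ᵥ charVec Y) (a, b) = (Y.filter fun g => g • a = b).card := by
  simp only [Matrix.mulVec, dotProduct, incidence, charVec, Matrix.conjTranspose_apply,
    Matrix.of_apply, mul_ite, mul_one, mul_zero, Finset.sum_ite_mem, Finset.univ_inter]
  simp [apply_ite]

/-- Since `E_χ` is a Hermitian idempotent, the double sum is `‖E_χ 1_Y‖²`. -/
theorem dualDist_eq_zero_iff {Y : Finset G} (hY : Y.Nonempty) (χ : IrrChar G) :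
    dualDist Y χ = 0 ↔ idem χ *ᵥ charVec Y = 0 := by
  classical
  have h1 : ∑ x ∈ Y, ∑ y ∈ Y, idem χ x y =
      star (idem χ *ᵥ charVec Y) ⬝ᵥ (idem χ *ᵥ charVec Y) := by
    rw [Matrix.star_mulVec, ← Matrix.dotProduct_mulVec, (isHermitian_idem χ).eq,
      Matrix.mulVec_mulVec, idem_mul_idem, if_pos rfl]
    simp [dotProduct, Matrix.mulVec, charVec, Finset.sum_ite_mem, apply_ite]
  have hc : (Fintype.card G : ℂ) / Y.card ≠ 0 :=
    div_ne_zero (by simp) (by simpa using hY.ne_empty)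
  rw [dualDist, mul_eq_zero, or_iff_right hc, h1, dotProduct_star_self_eq_zero]

theorem idem_mulVec_one {χ : IrrChar G} (h : χ.1 ≠ fun _ => 1) :
    idem χ *ᵥ (fun _ => 1) = 0 := by
  classical
  have h0 := IrrChar.sum_inv_mul χ ⟨_, isIrrChar_one⟩
  rw [if_neg (fun h' => h (congrArg Subtype.val h')), ← Equiv.sum_comp (Equiv.inv G)] at h0
  funext x
  have h1 := Equiv.sum_comp (Equiv.mulLeft x⁻¹) χ.1
  simp only [Equiv.coe_mulLeft] at h1
  simp only [Equiv.inv_apply, inv_inv, mul_one] at h0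
  simp [Matrix.mulVec, dotProduct, idem, ← Finset.mul_sum, h1, h0]

-- With `a = hc` and `b = kd`, the map `g ↦ k⁻¹gh` is a bijection between the two sets.
open Classical in
omit [Fintype Ω] in
theorem card_filter_smul_eq [MulAction.IsPretransitive G Ω] (a b c d : Ω) :
    (Finset.univ.filter fun g : G => g • a = b).card =
      (Finset.univ.filter fun g : G => g • c = d).card := by
  obtain ⟨h, rfl⟩ := MulAction.exists_smul_eq G c a
  obtain ⟨k, rfl⟩ := MulAction.exists_smul_eq G d b
  rw [← Fintype.card_subtype, ← Fintype.card_subtype]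
  refine Fintype.card_congr
    (((Equiv.mulRight h).trans (Equiv.mulLeft k⁻¹)).subtypeEquiv fun g => ?_)
  simp [mul_smul, inv_smul_eq_iff]

open Classical in
omit [Fintype Ω] in
theorem card_filter_smul_pos [MulAction.IsPretransitive G Ω] (a b : Ω) :
    0 < (Finset.univ.filter fun g : G => g • a = b).card := by
  obtain ⟨h, hh⟩ := MulAction.exists_smul_eq G a b
  exact Finset.card_pos.2 ⟨h, by simpa using hh⟩

omit [Group G] in
theorem charVec_univ : charVec (Finset.univ : Finset G) = fun _ => 1 := by
  funext g; simp [charVec]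

open Classical in
theorem idem_trivial_mulVec (Y : Finset G) {χ : IrrChar G} (h : χ.1 = fun _ => 1) :
    idem χ *ᵥ charVec Y = fun _ => (Y.card : ℂ) / Fintype.card G := by
  funext x
  simp [Matrix.mulVec, dotProduct, idem, h, charVec, div_eq_mul_inv]

theorem isTransitiveSubset_iff [MulAction.IsPretransitive G Ω] {Y : Finset G} (hY : Y.Nonempty) :
    IsTransitiveSubset Ω Y ↔
      ∀ χ : IrrChar G, IsConstituent Ω χ → χ.1 ≠ (fun _ => 1) → dualDist Y χ = 0 := by
  classical
  simp only [dualDist_eq_zero_iff hY]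
  have hG : (Fintype.card G : ℂ) ≠ 0 := by simp
  rcases isEmpty_or_nonempty Ω with hΩ | ⟨⟨o⟩⟩
  -- For empty `Ω` any positive constant works, and `Mᴴ 1_Y` has no entries.
  · refine iff_of_true ⟨1, one_pos, fun a => isEmptyElim a⟩ fun χ hχ _ => ?_
    exact (conjTranspose_incidence_mulVec_eq_zero_iff (Ω := Ω) _).1
      (funext fun p => isEmptyElim p) χ hχ
  let k : ℕ := (Finset.univ.filter fun g : G => g • o = o).card
  have hk : k ≠ 0 := (card_filter_smul_pos o o).ne'
  have hG1 : (incidence G Ω)ᴴ *ᵥ charVec Finset.univ = fun _ => (k : ℂ) := by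
    funext ⟨a, b⟩
    rw [conjTranspose_incidence_mulVec_charVec, card_filter_smul_eq a b o o]
  constructor
  · rintro ⟨c, -, hc⟩ χ hχ h1
    have hY1 : (incidence G Ω)ᴴ *ᵥ charVec Y = fun _ => (c : ℂ) := by
      funext ⟨a, b⟩
      rw [conjTranspose_incidence_mulVec_charVec, hc]
    have h2 : (incidence G Ω)ᴴ *ᵥ ((k : ℂ) • charVec Y - (c : ℂ) • charVec Finset.univ) = 0 := by
      rw [Matrix.mulVec_sub, Matrix.mulVec_smul, Matrix.mulVec_smul, hG1, hY1]
      funext p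
      simp [mul_comm]
    have h3 := (conjTranspose_incidence_mulVec_eq_zero_iff _).1 h2 χ hχ
    rw [Matrix.mulVec_sub, Matrix.mulVec_smul, Matrix.mulVec_smul, charVec_univ,
      idem_mulVec_one h1, smul_zero, sub_zero] at h3
    exact (smul_eq_zero.1 h3).resolve_left (by exact_mod_cast hk)
  · intro h
    -- The factor `|Y|/|G|` is the one that cancels the trivial component of `1_Y`.
    have h2 : (incidence G Ω)ᴴ *ᵥ
        (charVec Y - ((Y.card : ℂ) / Fintype.card G) • charVec Finset.univ) = 0 := by
      refine (conjTranspose_incidence_mulVec_eq_zero_iff _).2 fun χ hχ => ?_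
      rw [Matrix.mulVec_sub, Matrix.mulVec_smul]
      by_cases h1 : χ.1 = fun _ => 1
      · rw [idem_trivial_mulVec Y h1, idem_trivial_mulVec _ h1]
        funext x
        simp
      · rw [h χ hχ h1, charVec_univ, idem_mulVec_one h1, smul_zero, sub_zero]
    have h3 : ∀ a b : Ω, ((Y.filter fun g => g • a = b).card : ℂ) =
        (Y.card : ℂ) / Fintype.card G * k := by
      intro a b
      have := congrFun h2 (a, b)
      rw [Matrix.mulVec_sub, Matrix.mulVec_smul, hG1, Pi.sub_apply,
        conjTranspose_incidence_mulVec_charVec] at this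
      exact sub_eq_zero.1 this
    -- All counts equal `k|Y|/|G|`, which is nonzero.
    refine ⟨(Y.filter fun g => g • o = o).card, Nat.pos_of_ne_zero fun h0 => ?_, fun a b => ?_⟩
    · have h4 := h3 o o
      rw [h0, Nat.cast_zero, eq_comm] at h4
      exact mul_ne_zero (div_ne_zero (by simpa using hY.ne_empty) hG) (by exact_mod_cast hk) h4
    · exact_mod_cast (h3 a b).trans (h3 o o).symm

end Action
end ConjScheme

open ConjScheme in
open Classical in
theorem theorem2p4 {G Ω : Type*} [Group G] [Fintype G] [Fintype Ω] [MulAction G Ω] :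
    -- the matrices `E_χ` are the minimal idempotents of the Bose-Mesner algebra: a basis of it
    -- that consists of Hermitian, pairwise orthogonal idempotents
    (LinearIndependent ℂ (idem : IrrChar G → Matrix G G ℂ) ∧
      Submodule.span ℂ (Set.range (idem : IrrChar G → Matrix G G ℂ)) = boseMesner G ∧
      (∀ χ : IrrChar G, (idem χ).IsHermitian) ∧
      (∀ χ ψ : IrrChar G, idem χ * idem ψ = if χ = ψ then idem χ else 0)) ∧
    -- the column space of the incidence matrix is the direct sum of the `V_χ`
    (colSpace (incidence G Ω) = ⨆ χ : {χ : IrrChar G // IsConstituent Ω χ}, eigenspace χ.1) ∧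
    (iSupIndep fun χ : {χ : IrrChar G // IsConstituent Ω χ} => eigenspace χ.1) ∧
    -- the characterization of transitive subsets
    (MulAction.IsPretransitive G Ω → ∀ Y : Finset G, Y.Nonempty →
      (IsTransitiveSubset Ω Y ↔
        ∀ χ : IrrChar G, IsConstituent Ω χ → χ.1 ≠ (fun _ => 1) → dualDist Y χ = 0)) := by
  refine ⟨⟨linearIndependent_idem, span_idem, isHermitian_idem, fun χ ψ => ?_⟩,
    colSpace_incidence, iSupIndep_eigenspace.comp Subtype.val_injective,
    fun _ Y hY => isTransitiveSubset_iff hY⟩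
  exact idem_mul_idem χ ψ
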